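/- Let $F$ be a probability distribution on the Borel sets of $\mathbb R$. Its Fisher information of scale is $$\mathcal I_{s1}(F):=\sup_{\varphi}\frac{\bigl(\int x\,\varphi'(x)\,F(dx)\bigr)^2}{\int\varphi^2(x)\,F(dx)}\in[0,\infty],$$ where $\varphi$ ranges over all differentiable functions $\varphi:\mathbb R\to\mathbb R$ whose derivative is continuous with compact support, and where $0/0:=0$ and $a/0:=\infty$ for $a>0$. For $\sigma>0$ let $F_\sigma$ be the distribution with distribution function $x\mapsto F(x/\sigma)$, and let $F_0:=F-F(\{0\})\,\delta_0$ be $F$ with its mass at zero removed. Assume that $\mathcal I_{s1}(F)<\infty$. Then $F_0$ has a Lebesgue density $f\ge 0$ for which $x\mapsto x f(x)$ is absolutely continuous on $\mathbb R$; and for any such $f$, setting $\Lambda(x):=-[x f(x)]'/f(x)$ for $x\neq 0$, $\Lambda(0):=0$, and $\Lambda_\sigma(x):=\sigma^{-1}\Lambda(x/\sigma)$ (with an arbitrary fixed value, such as $0$, for $\Lambda$ at the points $x\ne0$ where this quotient is undefined; these form an $F$-null set), the scale model $(F_\sigma)_{0<\sigma<\infty}$ is $L_2$-differentiable with derivative $\Lambda_\sigma$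 at every $0<\sigma<\infty$, that is, $\int\Lambda_\sigma^2\,dF_\sigma<\infty$ and $$\Bigl\|\sqrt{dF_{\sigma+t}}-\sqrt{dF_\sigma}\,\bigl(1+\tfrac12 t\Lambda_\sigma\bigr)\Bigr\|=o(t)\qquad\text{as }t\to0 .$$ Here $\|\sqrt{dQ}-g\sqrt{dP}\|$ denotes the $L_2(\mu)$-norm of $\sqrt{dQ/d\mu}-g\sqrt{dP/d\mu}$ for any $\sigma$-finite measure $\mu$ dominating $Q$ and $P$ (it does not depend on $\mu$). In particular, $F$ may have an atom at $0$. -/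

import Mathlib

open MeasureTheory Filter Topology Asymptotics
open scoped ENNReal

noncomputable section

/-- The test class: differentiable functions `φ : ℝ → ℝ` whose derivative is continuous and has
compact support (`φ` itself need not have compact support, but it is bounded). -/
def scaleTestFunctions : Set (ℝ → ℝ) :=
  {φ | Differentiable ℝ φ ∧ Continuous (deriv φ) ∧ HasCompactSupport (deriv φ)}

/-- Fisher information of scale of a distribution `F` on the real line,
`sup_φ (∫ x φ'(x) F(dx))² / ∫ φ² dF`, as an extended nonnegative number.
For finite `F` all the integrands are bounded and hence integrable. In `ℝ≥0∞` one has `0 / 0 = 0`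
and `a / 0 = ∞` for `a ≠ 0`. -/
def fisherInfoScale (F : Measure ℝ) : ℝ≥0∞ :=
  ⨆ φ ∈ scaleTestFunctions,
    ENNReal.ofReal ((∫ x, x * deriv φ x ∂F) ^ 2) / ENNReal.ofReal (∫ x, φ x ^ 2 ∂F)

/-- The scale family induced by `F`: for `σ > 0`, `F_σ` has distribution function `x ↦ F (x / σ)`,
that is, `F_σ` is the law of `σ X` for `X ∼ F`. (Only `σ > 0` matters.) -/
def scaleFamily (F : Measure ℝ) (σ : ℝ) : Measure ℝ :=
  F.map (fun x => σ * x)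

/-- The punctured measure `F₀ = F - F({0}) δ₀`, i.e. `F` with its mass at zero removed. -/
def puncture (F : Measure ℝ) : Measure ℝ :=
  F.restrict {0}ᶜ

/-- Absolute continuity of a function on the whole real line: for every `ε > 0` there is `δ > 0`
such that `∑ |m (b i) - m (a i)| < ε` for any finite collection of disjoint segments
`(a i, b i]` of total length less than `δ`. -/
def AbsolutelyContinuousOnLine (m : ℝ → ℝ) : Prop :=
  ∀ ε : ℝ, 0 < ε → ∃ δ : ℝ, 0 < δ ∧ ∀ (n : ℕ) (a b : Fin n → ℝ),
    (∀ i, a i ≤ b i) →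
    (∀ i j, i ≠ j → Disjoint (Set.Ioc (a i) (b i)) (Set.Ioc (a j) (b j))) →
    ∑ i, (b i - a i) < δ →
    ∑ i, |m (b i) - m (a i)| < ε

/-- `f` is a (Lebesgue) density of the punctured measure `F₀` in the version for which
`x ↦ x f(x)` is absolutely continuous. -/
structure IsScaleDensity (F : Measure ℝ) (f : ℝ → ℝ) : Prop where
  measurable : Measurable f
  nonneg : ∀ x, 0 ≤ f x
  density : puncture F = volume.withDensity (fun x => ENNReal.ofReal (f x))
  absCont : AbsolutelyContinuousOnLine (fun x => x * f x)

/-- The score function `Λ(x) = -[x f(x)]' / f(x)` for `x ≠ 0`, and `Λ(0) = 0`. -/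
def scaleScore (f : ℝ → ℝ) (x : ℝ) : ℝ :=
  if x = 0 then 0 else -deriv (fun y => y * f y) x / f x

/-- The score function at scale `σ`: `Λ_σ(x) = σ⁻¹ Λ(x / σ)`. -/
def scaleScoreAt (f : ℝ → ℝ) (σ : ℝ) (x : ℝ) : ℝ :=
  σ⁻¹ * scaleScore f (x / σ)

/-- The norm `‖√dQ - g √dP‖` in the Hilbert space of square roots of measures: with densities
`q`, `p` of `Q`, `P` with respect to a dominating measure `μ`, it is the `L₂(μ)` norm of
`√q - g √p`, which does not depend on the choice of `μ`; we take `μ = Q + P`. -/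
def sqrtMeasureDist (Q P : Measure ℝ) (g : ℝ → ℝ) : ℝ≥0∞ :=
  eLpNorm
    (fun x => √(Q.rnDeriv (Q + P) x).toReal - √(P.rnDeriv (Q + P) x).toReal * g x)
    2 (Q + P)

/-- `L₂`-differentiability at `θ`, with derivative `L`, of a family `P` of distributions with a
real parameter: `L ∈ L₂(P_θ)` and `‖√dP_{θ+t} - √dP_θ (1 + t L / 2)‖ = o(t)` as `t → 0`.
(Since `L ∈ L₂(P_θ)`, the norm is finite.) -/
def HasL2DerivAt (P : ℝ → Measure ℝ) (L : ℝ → ℝ) (θ : ℝ) : Prop :=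
  MemLp L 2 (P θ) ∧
    (fun t : ℝ => (sqrtMeasureDist (P (θ + t)) (P θ) (fun x => 1 + t / 2 * L x)).toReal)
      =o[𝓝 0] (fun t : ℝ => t)

end

/-!
By Riesz representation in `L₂(F)`, finite Fisher information yields a weak score `g ∈ L₂(F)` with
`∫ x φ' dF = ∫ φ g dF` for all test functions. By Fubini, the measure `x F(dx)` then has Lebesgue
density `y ↦ ∫_{[y, ∞)} g dF`. Inserting this once more shows that this density is absolutely
continuous with derivative `-g f`, where `f` denotes its quotient by `y`. So `f` is the required
density of `F₀` and its score is `g`, and `x f(x)`, hence the score, is the same for every version.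

For the differentiability, put `s_σ(x) = √(f(x/σ)/σ)`. Writing `s_τ(x) - s_σ(x)` as an integral
over `[x/τ, x/σ]`, Cauchy–Schwarz and Tonelli give `‖s_τ - s_σ‖² ≤ (τ - σ)² (4 σ τ)⁻¹ ∫ Λ² f`. As
`t → 0`, the resulting bound for the difference quotients `(s_{σ+t} - s_σ)/t` tends to the squared
norm of their pointwise limit `Λ_σ s_σ / 2`. Convergence of norms together with pointwise
convergence gives convergence in `L₂`, by Fatou's lemma and the parallelogram law; pointwise
convergence is only needed where the limit does not vanish, so the zeros of `f` cause no trouble.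
The atom at zero is the same in all `F_σ`.
-/

/-! ### The weak score -/

section WeakScore

variable {F : Measure ℝ} {φ g : ℝ → ℝ}

lemma sq_integral_mul_deriv_le (hF : fisherInfoScale F < ∞) (hφ : φ ∈ scaleTestFunctions) :
    (∫ x, x * deriv φ x ∂F) ^ 2 ≤ (fisherInfoScale F).toReal * ∫ x, φ x ^ 2 ∂F := by
  have hle : ENNReal.ofReal ((∫ x, x * deriv φ x ∂F) ^ 2) / ENNReal.ofReal (∫ x, φ x ^ 2 ∂F) ≤
      fisherInfoScale F := le_iSup₂_of_le (f := fun φ (_ : φ ∈ scaleTestFunctions) =>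
        ENNReal.ofReal ((∫ x, x * deriv φ x ∂F) ^ 2) / ENNReal.ofReal (∫ x, φ x ^ 2 ∂F)) φ hφ le_rfl
  rw [ENNReal.div_le_iff_le_mul (Or.inr hF.ne) (Or.inl ENNReal.ofReal_ne_top),
    ← ENNReal.ofReal_toReal hF.ne, ← ENNReal.ofReal_mul ENNReal.toReal_nonneg] at hle
  rwa [ENNReal.ofReal_le_ofReal_iff (by positivity)] at hle

variable [IsFiniteMeasure F]

lemma scaleTestFunctions.exists_bound (hφ : φ ∈ scaleTestFunctions) : ∃ C, ∀ x, ‖φ x‖ ≤ C := by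
  obtain ⟨hd, hc, hs⟩ := hφ
  have hint : Integrable (deriv φ) := hc.integrable_of_hasCompactSupport hs
  refine ⟨‖φ 0‖ + ∫ y, ‖deriv φ y‖, fun x => ?_⟩
  have hftc : φ x = φ 0 + ∫ y in (0 : ℝ)..x, deriv φ y := by
    rw [intervalIntegral.integral_deriv_eq_sub (fun y _ => hd y) (hc.intervalIntegrable _ _)]
    ring
  rw [hftc]
  refine (norm_add_le _ _).trans (add_le_add_right ?_ _)
  exact intervalIntegral.norm_integral_le_integral_norm_uIoc.trans
    (setIntegral_le_integral hint.norm (Eventually.of_forall fun _ => norm_nonneg _))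

lemma scaleTestFunctions.memLp (hφ : φ ∈ scaleTestFunctions) (p : ℝ≥0∞) : MemLp φ p F := by
  obtain ⟨C, hC⟩ := scaleTestFunctions.exists_bound hφ
  exact MemLp.of_bound hφ.1.continuous.aestronglyMeasurable C (Eventually.of_forall hC)

lemma scaleTestFunctions.integrable_mul_deriv (hφ : φ ∈ scaleTestFunctions) :
    Integrable (fun x => x * deriv φ x) F :=
  (continuous_id.mul hφ.2.1).integrable_of_hasCompactSupport hφ.2.2.mul_left

lemma scaleTestFunctions.of_contDiff (hφ : ContDiff ℝ 1 φ) (hs : HasCompactSupport φ) :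
    φ ∈ scaleTestFunctions :=
  ⟨hφ.differentiable one_ne_zero, hφ.continuous_deriv le_rfl, hs.deriv⟩

/-- The test class as a linear subspace of the functions on the line. -/
def scaleTestSpace : Submodule ℝ (ℝ → ℝ) where
  carrier := scaleTestFunctions
  add_mem' := by
    intro φ ψ hφ hψ
    have h : deriv (φ + ψ) = deriv φ + deriv ψ := funext fun x => deriv_add (hφ.1 x) (hψ.1 x)
    exact ⟨hφ.1.add hψ.1, by rw [h]; exact hφ.2.1.add hψ.2.1, by rw [h]; exact hφ.2.2.add hψ.2.2⟩
  zero_mem' := by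
    have h : deriv (0 : ℝ → ℝ) = 0 := funext fun x => deriv_const x 0
    exact ⟨differentiable_const 0, by rw [h]; exact continuous_const,
      by rw [h]; exact HasCompactSupport.zero⟩
  smul_mem' := by
    intro c φ hφ
    have h : deriv (c • φ) = c • deriv φ := funext fun x => deriv_const_smul c (hφ.1 x)
    exact ⟨hφ.1.const_smul c, by rw [h]; exact hφ.2.1.const_smul c,
      by rw [h]; exact hφ.2.2.smul_left (f := fun _ => c)⟩

variable (F) in
/-- The embedding of the test functions into `L₂(F)`. -/
noncomputable def scaleTestSpace.toL2 : scaleTestSpace →ₗ[ℝ] Lp ℝ 2 F where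
  toFun φ := (scaleTestFunctions.memLp φ.2 2).toLp φ.1
  map_add' _ _ := MemLp.toLp_add _ _
  map_smul' _ _ := MemLp.toLp_const_smul _ _

variable (F) in
/-- The functional `φ ↦ ∫ x φ'(x) F(dx)` whose norm in `L₂(F)` is the root of the Fisher
information of scale. -/
noncomputable def scaleTestSpace.scaleFunctional : scaleTestSpace →ₗ[ℝ] ℝ where
  toFun φ := ∫ x, x * deriv φ.1 x ∂F
  map_add' φ ψ := by
    rw [← integral_add (scaleTestFunctions.integrable_mul_deriv φ.2)
      (scaleTestFunctions.integrable_mul_deriv ψ.2)]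
    refine integral_congr_ae (Eventually.of_forall fun x => ?_)
    simp only [Submodule.coe_add, deriv_add (φ.2.1 x) (ψ.2.1 x), mul_add]
  map_smul' c φ := by
    rw [RingHom.id_apply, smul_eq_mul, ← integral_const_mul]
    refine integral_congr_ae (Eventually.of_forall fun x => ?_)
    simp only [Submodule.coe_smul, deriv_const_smul c (φ.2.1 x), smul_eq_mul, mul_left_comm]

lemma scaleTestSpace.inner_toL2 (u : Lp ℝ 2 F) (φ : scaleTestSpace) :
    inner ℝ u (toL2 F φ) = ∫ x, φ.1 x * u x ∂F := by
  rw [L2.inner_def]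
  refine integral_congr_ae ?_
  filter_upwards [(scaleTestFunctions.memLp (F := F) φ.2 2).coeFn_toLp] with x hx
  rw [toL2, LinearMap.coe_mk, AddHom.coe_mk, hx, RCLike.inner_apply, conj_trivial]

lemma scaleTestSpace.norm_toL2_sq (φ : scaleTestSpace) :
    ‖toL2 F φ‖ ^ 2 = ∫ x, φ.1 x ^ 2 ∂F := by
  rw [← real_inner_self_eq_norm_sq, inner_toL2]
  refine integral_congr_ae ?_
  filter_upwards [(scaleTestFunctions.memLp (F := F) φ.2 2).coeFn_toLp] with x hx
  rw [toL2, LinearMap.coe_mk, AddHom.coe_mk, hx, sq]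

lemma scaleTestSpace.norm_scaleFunctional_le (hF : fisherInfoScale F < ∞) (φ : scaleTestSpace) :
    ‖scaleFunctional F φ‖ ≤ √(fisherInfoScale F).toReal * ‖toL2 F φ‖ := by
  rw [← Real.sqrt_sq (norm_nonneg (toL2 F φ)), ← Real.sqrt_mul ENNReal.toReal_nonneg, norm_toL2_sq]
  exact Real.abs_le_sqrt (sq_integral_mul_deriv_le hF φ.2)

lemma exists_inner_eq_of_norm_le {V H : Type*} [AddCommGroup V] [Module ℝ V]
    [NormedAddCommGroup H] [InnerProductSpace ℝ H] [CompleteSpace H]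
    (T : V →ₗ[ℝ] H) (l : V →ₗ[ℝ] ℝ) (C : ℝ) (hl : ∀ v, ‖l v‖ ≤ C * ‖T v‖) :
    ∃ u : H, ∀ v, l v = inner ℝ u (T v) := by
  -- By the bound `l` vanishes on the kernel of `T`, so it factors through the range of `T`.
  have hmem : l ∈ T.dualMap.range := by
    rw [LinearMap.range_dualMap_eq_dualAnnihilator_ker, Submodule.mem_dualAnnihilator]
    intro v hv
    simpa [LinearMap.mem_ker.1 hv] using hl v
  obtain ⟨L, hL⟩ := hmem
  have hLT : ∀ v, L (T v) = l v := fun v => LinearMap.congr_fun hL v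
  let L₀ : StrongDual ℝ T.range := (L.comp T.range.subtype).mkContinuous C (by
    rintro ⟨_, v, rfl⟩
    simpa [hLT] using hl v)
  obtain ⟨G, hG, -⟩ := exists_extension_norm_eq T.range L₀
  refine ⟨(InnerProductSpace.toDual ℝ H).symm G, fun v => ?_⟩
  rw [InnerProductSpace.toDual_symm_apply, ← hLT v]
  exact (hG ⟨T v, v, rfl⟩).symm

/-- `g` is the score of scale of `F` in the weak sense: an element of `L₂(F)` representing the
functional `φ ↦ ∫ x φ'(x) F(dx)`. For a smooth density `f`, integration by parts gives
`g = -(x f)' / f`. -/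
structure IsWeakScaleScore (F : Measure ℝ) (g : ℝ → ℝ) : Prop where
  measurable : Measurable g
  memLp : MemLp g 2 F
  integral_mul_deriv : ∀ φ ∈ scaleTestFunctions, ∫ x, x * deriv φ x ∂F = ∫ x, φ x * g x ∂F

lemma IsWeakScaleScore.integrable (hg : IsWeakScaleScore F g) : Integrable g F :=
  hg.memLp.integrable one_le_two

lemma exists_isWeakScaleScore (hF : fisherInfoScale F < ∞) : ∃ g, IsWeakScaleScore F g := by
  obtain ⟨u, hu⟩ := exists_inner_eq_of_norm_le _ _ _ (scaleTestSpace.norm_scaleFunctional_le hF)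
  exact ⟨u, (Lp.stronglyMeasurable u).measurable, Lp.memLp u,
    fun φ hφ => (hu ⟨φ, hφ⟩).trans (scaleTestSpace.inner_toL2 u ⟨φ, hφ⟩)⟩

end WeakScore

/-! ### Absolute continuity on the line -/

section AbsolutelyContinuous

variable {m h : ℝ → ℝ}

lemma AbsolutelyContinuousOnLine.neg_comp_neg (hm : AbsolutelyContinuousOnLine m) :
    AbsolutelyContinuousOnLine fun x => -m (-x) := by
  intro ε hε
  obtain ⟨δ, hδ, H⟩ := hm ε hε
  refine ⟨δ, hδ, fun n a b hab hdisj hlen => ?_⟩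
  simp only [neg_sub_neg]
  refine H n (fun i => -b i) (fun i => -a i) (fun i => neg_le_neg (hab i)) (fun i j hij => ?_) ?_
  · have := Set.Ioc_disjoint_Ioc.1 (hdisj i j hij)
    rwa [Set.Ioc_disjoint_Ioc, min_neg_neg, max_neg_neg, neg_le_neg_iff]
  · simpa only [neg_sub_neg] using hlen

lemma AbsolutelyContinuousOnLine.absolutelyContinuousOnInterval
    (hm : AbsolutelyContinuousOnLine m) (a b : ℝ) : AbsolutelyContinuousOnInterval m a b := by
  rw [absolutelyContinuousOnInterval_iff]
  intro ε hε
  obtain ⟨δ, hδ, H⟩ := hm ε hε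
  refine ⟨δ, hδ, fun ⟨n, I⟩ ⟨_, hdisj⟩ hlen => ?_⟩
  have hsum := H n (fun i => min (I i).1 (I i).2) (fun i => max (I i).1 (I i).2)
    (fun _ => min_le_max)
    (fun i j hij => hdisj (Finset.mem_coe.2 (Finset.mem_range.2 i.2))
      (Finset.mem_coe.2 (Finset.mem_range.2 j.2)) (Fin.val_ne_of_ne hij))
    (by simpa only [max_sub_min_eq_abs', ← Real.dist_eq, Finset.sum_range] using hlen)
  rw [Finset.sum_range]
  refine lt_of_eq_of_lt (Finset.sum_congr rfl fun i _ => ?_) hsum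
  rcases le_total (I i).1 (I i).2 with hle | hle
  · rw [min_eq_left hle, max_eq_right hle, dist_comm, Real.dist_eq]
  · rw [min_eq_right hle, max_eq_left hle, Real.dist_eq]

lemma AbsolutelyContinuousOnLine.continuous (hm : AbsolutelyContinuousOnLine m) :
    Continuous m :=
  continuous_iff_continuousAt.2 fun x =>
    (hm.absolutelyContinuousOnInterval (x - 1) (x + 1)).continuousOn.continuousAt
      (by rw [Set.uIcc_of_le (by linarith)]; exact Icc_mem_nhds (by linarith) (by linarith))

lemma AbsolutelyContinuousOnLine.ae_differentiableAt (hm : AbsolutelyContinuousOnLine m) :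
    ∀ᵐ x, DifferentiableAt ℝ m x := by
  have hn : ∀ᵐ x, ∀ n : ℕ, x ∈ Set.uIcc (-n : ℝ) n → DifferentiableAt ℝ m x :=
    ae_all_iff.2 fun n => (hm.absolutelyContinuousOnInterval (-n) n).ae_differentiableAt
  filter_upwards [hn] with x hx
  obtain ⟨n, hxn⟩ := exists_nat_ge |x|
  refine hx n ?_
  rw [Set.uIcc_of_le (by linarith [abs_nonneg x])]
  exact abs_le.1 hxn

lemma absolutelyContinuousOnLine_of_integral (hh : Integrable h)
    (hm : ∀ a b, m b - m a = ∫ x in a..b, h x) : AbsolutelyContinuousOnLine m := by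
  intro ε hε
  obtain ⟨δ, hδ, hsmall⟩ := exists_pos_setLIntegral_lt_of_measure_lt (μ := volume)
    (f := fun x => ‖h x‖ₑ) hh.2.ne (ε := ENNReal.ofReal ε) (by simpa using hε)
  obtain ⟨δ', hδ', hle⟩ : ∃ δ' : ℝ, 0 < δ' ∧ ENNReal.ofReal δ' ≤ δ := by
    rcases eq_or_ne δ ∞ with rfl | h
    · exact ⟨1, one_pos, le_top⟩
    · exact ⟨δ.toReal, ENNReal.toReal_pos hδ.ne' h, ENNReal.ofReal_toReal_le⟩
  refine ⟨δ', hδ', fun n a b hab hdisj hlen => ?_⟩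
  have hvol : volume (⋃ i, Set.Ioc (a i) (b i)) < δ := by
    calc volume (⋃ i, Set.Ioc (a i) (b i)) ≤ ∑ i, volume (Set.Ioc (a i) (b i)) :=
          measure_iUnion_fintype_le _ _
      _ = ENNReal.ofReal (∑ i, (b i - a i)) := by
          simp only [ENNReal.ofReal_sum_of_nonneg fun i _ => sub_nonneg.2 (hab i), Real.volume_Ioc]
      _ < ENNReal.ofReal δ' := (ENNReal.ofReal_lt_ofReal_iff hδ').2 hlen
      _ ≤ δ := hle
  rw [← ENNReal.ofReal_lt_ofReal_iff hε]
  calc ENNReal.ofReal (∑ i, |m (b i) - m (a i)|)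
      = ∑ i, ‖∫ x in Set.Ioc (a i) (b i), h x‖ₑ := by
        rw [ENNReal.ofReal_sum_of_nonneg fun i _ => abs_nonneg _]
        refine Finset.sum_congr rfl fun i _ => ?_
        rw [hm, intervalIntegral.integral_of_le (hab i), ← Real.norm_eq_abs, ofReal_norm]
    _ ≤ ∑ i, ∫⁻ x in Set.Ioc (a i) (b i), ‖h x‖ₑ :=
        Finset.sum_le_sum fun i _ => enorm_integral_le_lintegral_enorm _
    _ = ∫⁻ x in ⋃ i, Set.Ioc (a i) (b i), ‖h x‖ₑ := by
        rw [lintegral_iUnion (fun i => measurableSet_Ioc) (fun i j hij => hdisj i j hij),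
          tsum_fintype]
    _ < ENNReal.ofReal ε := hsmall _ hvol

lemma ae_hasDerivAt_of_integral (hh : Integrable h)
    (hm : ∀ a b, m b - m a = ∫ x in a..b, h x) : ∀ᵐ x, HasDerivAt m (h x) x := by
  have hm0 : m = fun x => m 0 + ∫ t in (0 : ℝ)..x, h t := funext fun x => by rw [← hm 0 x]; ring
  filter_upwards [LocallyIntegrable.ae_hasDerivAt_integral hh.locallyIntegrable] with x hx
  rw [hm0]
  exact (hx 0).const_add _

end AbsolutelyContinuous

/-! ### Measures with weakly equal multiples -/

section WeaklyEqual

variable {E : Type*} [NormedAddCommGroup E] [NormedSpace ℝ E] [FiniteDimensional ℝ E]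
  [MeasurableSpace E] [BorelSpace E] {μ ν : Measure E} [SigmaFinite μ] [SigmaFinite ν] {u v : E → ℝ}

lemma locallyIntegrable_toReal_rnDeriv_mul (hμν : μ ≪ ν) (hu : LocallyIntegrable u μ) :
    LocallyIntegrable (fun x => (μ.rnDeriv ν x).toReal * u x) ν := by
  have : ProperSpace E := FiniteDimensional.proper_real E
  refine locallyIntegrable_iff.2 fun K hK => ?_
  have hKu : Integrable (fun x => (μ.rnDeriv ν x).toReal * K.indicator u x) ν :=
    (integrable_toReal_rnDeriv_mul_iff hμν).2
      ((integrable_indicator_iff hK.measurableSet).2 (hu.integrableOn_isCompact hK))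
  rw [← integrable_indicator_iff hK.measurableSet]
  exact hKu.congr (Eventually.of_forall fun x =>
    (Set.indicator_mul_right K (fun x => (μ.rnDeriv ν x).toReal) u).symm)

variable (hu : LocallyIntegrable u μ) (hv : LocallyIntegrable v ν)
  (h : ∀ ψ : E → ℝ, ContDiff ℝ (⊤ : ℕ∞) ψ → HasCompactSupport ψ →
    ∫ x, ψ x * u x ∂μ = ∫ x, ψ x * v x ∂ν)
include hu hv h

lemma toReal_rnDeriv_mul_ae_eq_of_integral_mul_eq :
    ∀ᵐ x ∂(μ + ν),
      (μ.rnDeriv (μ + ν) x).toReal * u x = (ν.rnDeriv (μ + ν) x).toReal * v x := by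
  have hμ : μ ≪ μ + ν := (Measure.le_add_right le_rfl).absolutelyContinuous
  have hν : ν ≪ μ + ν := (Measure.le_add_left le_rfl).absolutelyContinuous
  refine ae_eq_of_integral_contDiff_smul_eq (locallyIntegrable_toReal_rnDeriv_mul hμ hu)
    (locallyIntegrable_toReal_rnDeriv_mul hν hv) fun ψ hψ hs => ?_
  simp only [smul_eq_mul, mul_left_comm (ψ _)]
  rw [integral_toReal_rnDeriv_mul hμ, integral_toReal_rnDeriv_mul hν, h ψ hψ hs]

lemma ae_div_nonneg_of_integral_mul_eq : ∀ᵐ x ∂ν, 0 ≤ v x / u x := by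
  have hν : ν ≪ μ + ν := (Measure.le_add_left le_rfl).absolutelyContinuous
  filter_upwards [hν.ae_le (toReal_rnDeriv_mul_ae_eq_of_integral_mul_eq hu hv h),
    Measure.rnDeriv_pos hν, hν.ae_le (ν.rnDeriv_lt_top (μ + ν))] with x hx hpos hlt
  have hpos' := ENNReal.toReal_pos hpos.ne' hlt.ne
  rw [mul_comm _ (v x), ← div_eq_iff hpos'.ne'] at hx
  have huu : 0 ≤ u x / u x := by rcases eq_or_ne (u x) 0 with h0 | h0 <;> simp [h0]
  rw [← hx, div_right_comm, mul_div_assoc]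
  positivity

lemma restrict_ne_zero_eq_withDensity_div (hum : Measurable u) (hvm : Measurable v) :
    μ.restrict {x | u x ≠ 0} =
      (ν.restrict {x | u x ≠ 0}).withDensity fun x => ENNReal.ofReal (v x / u x) := by
  have hμ : μ ≪ μ + ν := (Measure.le_add_right le_rfl).absolutelyContinuous
  have hν : ν ≪ μ + ν := (Measure.le_add_left le_rfl).absolutelyContinuous
  have hS : MeasurableSet {x | u x ≠ 0} := (hum (measurableSet_singleton 0)).compl
  have hdiv : Measurable fun x => ENNReal.ofReal (v x / u x) := (hvm.div hum).ennreal_ofReal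
  rw [← restrict_withDensity hS]
  conv_lhs => rw [← Measure.withDensity_rnDeriv_eq μ (μ + ν) hμ]
  conv_rhs => rw [← Measure.withDensity_rnDeriv_eq ν (μ + ν) hν]
  rw [← withDensity_mul _ (Measure.measurable_rnDeriv _ _) hdiv, restrict_withDensity hS,
    restrict_withDensity hS]
  refine withDensity_congr_ae ((ae_restrict_iff' hS).2 ?_)
  filter_upwards [toReal_rnDeriv_mul_ae_eq_of_integral_mul_eq hu hv h, μ.rnDeriv_lt_top (μ + ν),
    ν.rnDeriv_lt_top (μ + ν)] with x hx hμx hνx (hux : u x ≠ 0)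
  rw [Pi.mul_apply, ← ENNReal.ofReal_toReal hμx.ne, ← ENNReal.ofReal_toReal hνx.ne,
    ← ENNReal.ofReal_mul ENNReal.toReal_nonneg, ← mul_div_assoc, ← hx, mul_div_cancel_right₀ _ hux]

end WeaklyEqual

/-! ### The density of the punctured measure -/

section Density

variable {F : Measure ℝ} {φ ψ g h : ℝ → ℝ}

lemma tendsto_integral_comp_mul_mul_atTop (hφ : Continuous φ) (hs : HasCompactSupport φ)
    (hh : Integrable h F) :
    Tendsto (fun c : ℝ => ∫ x, φ (c * x) * h x ∂F) atTop (𝓝 (φ 0 * ∫ x in {0}, h x ∂F)) := by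
  obtain ⟨C, hC⟩ := hs.exists_bound_of_continuous hφ
  rw [← integral_const_mul, ← integral_indicator (measurableSet_singleton 0)]
  refine tendsto_integral_filter_of_dominated_convergence (fun x => C * ‖h x‖)
    (Eventually.of_forall fun c => ?_)
    (Eventually.of_forall fun c => Eventually.of_forall fun x => ?_)
    (hh.norm.const_mul C) (Eventually.of_forall fun x => ?_)
  · exact (hφ.comp (continuous_const_mul c)).aestronglyMeasurable.mul hh.aestronglyMeasurable
  · rw [norm_mul]
    exact mul_le_mul_of_nonneg_right (hC _) (norm_nonneg _)
  · rcases eq_or_ne x 0 with rfl | hx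
    · simp
    · have hinf : Tendsto (fun c : ℝ => φ (c * x)) atTop (𝓝 0) :=
        hs.is_zero_at_infty.comp
          ((Homeomorph.mulRight₀ x hx).isClosedEmbedding.tendsto_cocompact.mono_left
            atTop_le_cocompact)
      simpa [hx] using hinf.mul_const (h x)

lemma scaleTestFunctions.comp_mul_left (hφ : φ ∈ scaleTestFunctions) {c : ℝ} (hc : c ≠ 0) :
    (fun x => φ (c * x)) ∈ scaleTestFunctions := by
  have hderiv : deriv (fun x => φ (c * x)) = fun x => c * deriv φ (c * x) :=
    funext fun x => deriv_comp_mul_left c φ x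
  refine ⟨hφ.1.comp (differentiable_id.const_mul c), ?_, ?_⟩
  · rw [hderiv]
    exact (hφ.2.1.comp (continuous_const_mul c)).const_mul c
  · rw [hderiv]
    exact (hφ.2.2.comp_homeomorph (Homeomorph.mulLeft₀ c hc)).mul_left

lemma IsWeakScaleScore.setIntegral_singleton_zero [IsFiniteMeasure F] (hg : IsWeakScaleScore F g) :
    ∫ x in {0}, g x ∂F = 0 := by
  let η : ContDiffBump (0 : ℝ) := ⟨1, 2, one_pos, one_lt_two⟩
  have hη : ContDiff ℝ 1 η := η.contDiff
  have hηt := scaleTestFunctions.of_contDiff hη η.hasCompactSupport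
  have hη0 : η 0 = 1 := η.one_of_mem_closedBall (Metric.mem_closedBall_self zero_le_one)
  have hleft : Tendsto (fun c : ℝ => ∫ x, c * x * deriv η (c * x) * 1 ∂F) atTop (𝓝 0) := by
    simpa using tendsto_integral_comp_mul_mul_atTop (F := F) (continuous_id.mul hηt.2.1)
      hηt.2.2.mul_left (integrable_const 1)
  have hright := tendsto_integral_comp_mul_mul_atTop hη.continuous η.hasCompactSupport hg.integrable
  rw [hη0, one_mul] at hright
  refine tendsto_nhds_unique_of_eventuallyEq hright hleft ?_
  filter_upwards [eventually_ne_atTop 0] with c hc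
  rw [← hg.integral_mul_deriv _ (scaleTestFunctions.comp_mul_left hηt hc)]
  refine integral_congr_ae (Eventually.of_forall fun x => ?_)
  simp only [deriv_comp_mul_left, smul_eq_mul]
  ring

lemma hasDerivAt_integral_Iic (hψ : Continuous ψ) (hi : Integrable ψ) (x : ℝ) :
    HasDerivAt (fun x => ∫ y in Set.Iic x, ψ y) (ψ x) x := by
  have hIic : (fun x => ∫ y in Set.Iic x, ψ y) =
      fun x => (∫ y in Set.Iic (0 : ℝ), ψ y) + ∫ y in (0 : ℝ)..x, ψ y := by
    ext x
    rw [← intervalIntegral.integral_Iic_sub_Iic hi.integrableOn hi.integrableOn]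
    ring
  rw [hIic]
  exact (intervalIntegral.integral_hasDerivAt_right (hψ.intervalIntegrable _ _)
    (hψ.stronglyMeasurableAtFilter _ _) hψ.continuousAt).const_add _

lemma eq_zero_of_mul_nonneg {m : ℝ → ℝ} (hm : Continuous m) (h : ∀ x, 0 ≤ x * m x) : m 0 = 0 := by
  refine le_antisymm ?_ ?_
  · refine le_of_tendsto (hm.continuousAt.mono_left (nhdsWithin_le_nhds (s := Set.Iio 0))) ?_
    filter_upwards [self_mem_nhdsWithin] with x hx
    exact nonpos_of_mul_nonneg_right (h x) hx
  · refine ge_of_tendsto (hm.continuousAt.mono_left (nhdsWithin_le_nhds (s := Set.Ioi 0))) ?_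
    filter_upwards [self_mem_nhdsWithin] with x hx
    exact nonneg_of_mul_nonneg_right (h x) hx

lemma measurable_scaleScore {f : ℝ → ℝ} (hf : Measurable f) : Measurable (scaleScore f) :=
  Measurable.ite (measurableSet_singleton 0) measurable_const ((measurable_deriv _).neg.div hf)

lemma memLp_puncture_iff {k : ℝ → ℝ} {p : ℝ≥0∞} (hk : k 0 = 0) :
    MemLp k p (puncture F) ↔ MemLp k p F := by
  rw [puncture, ← memLp_indicator_iff_restrict (measurableSet_singleton 0).compl,
    Set.indicator_eq_self.2 (Function.support_subset_iff'.2 fun x hx => ?_)]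
  rwa [Set.notMem_compl_iff.1 hx]

/-- The tail integral `y ↦ ∫_{[y, ∞)} g dF`. If `g` is the score of scale of `F`, it is the density
of the measure `x F(dx)`, that is, the function `x ↦ x f(x)`. -/
noncomputable def scoreTail (F : Measure ℝ) (g : ℝ → ℝ) (y : ℝ) : ℝ :=
  ∫ x in Set.Ici y, g x ∂F

lemma norm_scoreTail_le (hg : Integrable g F) (y : ℝ) : ‖scoreTail F g y‖ ≤ ∫ x, ‖g x‖ ∂F :=
  (norm_integral_le_integral_norm _).trans
    (setIntegral_le_integral hg.norm (Eventually.of_forall fun _ => norm_nonneg _))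

lemma measurable_scoreTail [SFinite F] (hg : Measurable g) : Measurable (scoreTail F g) := by
  have hind : StronglyMeasurable ({p : ℝ × ℝ | p.1 ≤ p.2}.indicator fun p => g p.2) :=
    ((hg.comp measurable_snd).indicator
      (measurableSet_le measurable_fst measurable_snd)).stronglyMeasurable
  convert (hind.integral_prod_right' (ν := F)).measurable using 1
  ext y
  rw [scoreTail, ← integral_indicator measurableSet_Ici]
  rfl

lemma integral_integral_Iic_mul [SFinite F] (hg : Integrable g F) (hi : Integrable ψ) :
    ∫ x, (∫ y in Set.Iic x, ψ y) * g x ∂F = ∫ y, ψ y * scoreTail F g y := by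
  let H : ℝ × ℝ → ℝ := {p : ℝ × ℝ | p.2 ≤ p.1}.indicator fun p => g p.1 * ψ p.2
  have hint : Integrable H (F.prod volume) :=
    (hg.mul_prod hi).indicator (measurableSet_le measurable_snd measurable_fst)
  have hfst : ∀ x, (∫ y in Set.Iic x, ψ y) * g x = ∫ y, H (x, y) := fun x => by
    rw [mul_comm, ← integral_const_mul, ← integral_indicator measurableSet_Iic]
    rfl
  have hsnd : ∀ y, ψ y * scoreTail F g y = ∫ x, H (x, y) ∂F := fun y => by
    rw [scoreTail, mul_comm, ← integral_mul_const, ← integral_indicator measurableSet_Ici]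
    rfl
  simp only [hfst, hsnd]
  exact integral_integral_swap (f := fun x y => H (x, y)) hint

variable [IsFiniteMeasure F] (hg : IsWeakScaleScore F g)
include hg

lemma IsWeakScaleScore.integral_mul_self_eq (hψ : Continuous ψ) (hs : HasCompactSupport ψ) :
    ∫ x, ψ x * x ∂F = ∫ y, ψ y * scoreTail F g y := by
  have hi : Integrable ψ := hψ.integrable_of_hasCompactSupport hs
  have hderiv : deriv (fun x => ∫ y in Set.Iic x, ψ y) = ψ :=
    funext fun x => (hasDerivAt_integral_Iic hψ hi x).deriv
  have htest : (fun x => ∫ y in Set.Iic x, ψ y) ∈ scaleTestFunctions :=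
    ⟨fun x => (hasDerivAt_integral_Iic hψ hi x).differentiableAt, by rwa [hderiv], by rwa [hderiv]⟩
  rw [← integral_integral_Iic_mul hg.integrable hi, ← hg.integral_mul_deriv _ htest, hderiv]
  simp only [mul_comm]

lemma IsWeakScaleScore.measurable_scoreTail_div : Measurable fun x => scoreTail F g x / x :=
  (measurable_scoreTail hg.measurable).div measurable_id

lemma IsWeakScaleScore.locallyIntegrable_scoreTail : LocallyIntegrable (scoreTail F g) :=
  (locallyIntegrable_const (∫ x, ‖g x‖ ∂F)).mono
    (measurable_scoreTail hg.measurable).aestronglyMeasurable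
    (Eventually.of_forall fun x => (norm_scoreTail_le hg.integrable x).trans (le_abs_self _))

lemma IsWeakScaleScore.ae_scoreTail_div_nonneg : ∀ᵐ x, 0 ≤ scoreTail F g x / x :=
  ae_div_nonneg_of_integral_mul_eq (μ := F) continuous_id.locallyIntegrable
    hg.locallyIntegrable_scoreTail fun _ hψ hs => hg.integral_mul_self_eq hψ.continuous hs

lemma IsWeakScaleScore.puncture_eq :
    puncture F = volume.withDensity fun x => ENNReal.ofReal (scoreTail F g x / x) := by
  have hrestrict := restrict_ne_zero_eq_withDensity_div (μ := F) continuous_id.locallyIntegrable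
    hg.locallyIntegrable_scoreTail (fun _ hψ hs => hg.integral_mul_self_eq hψ.continuous hs)
    measurable_id (measurable_scoreTail hg.measurable)
  have hvol : (volume : Measure ℝ).restrict {x | id x ≠ 0} = volume := by
    rw [Measure.restrict_eq_self_of_ae_mem]
    exact Measure.ae_ne volume 0
  rw [hvol] at hrestrict
  exact hrestrict

lemma IsWeakScaleScore.integrable_mul_scoreTail_div :
    Integrable fun x => g x * (scoreTail F g x / x) := by
  have hgp : Integrable g (puncture F) := hg.integrable.mono_measure Measure.restrict_le_self
  rw [hg.puncture_eq, integrable_withDensity_iff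
    hg.measurable_scoreTail_div.ennreal_ofReal
    (Eventually.of_forall fun _ => ENNReal.ofReal_lt_top)] at hgp
  refine hgp.congr ?_
  filter_upwards [hg.ae_scoreTail_div_nonneg] with x hx
  rw [ENNReal.toReal_ofReal hx]

lemma IsWeakScaleScore.setIntegral_eq {s : Set ℝ} (hs : MeasurableSet s) :
    ∫ x in s, g x ∂F = ∫ x in s, g x * (scoreTail F g x / x) := by
  have hzero : ∫ x in s ∩ {0}, g x ∂F = 0 := by
    by_cases h0 : (0 : ℝ) ∈ s
    · rw [Set.inter_eq_right.2 (Set.singleton_subset_iff.2 h0), hg.setIntegral_singleton_zero]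
    · rw [Set.inter_singleton_eq_empty.2 h0, setIntegral_empty]
  calc ∫ x in s, g x ∂F = ∫ x in s \ {0}, g x ∂F := by
        rw [← integral_inter_add_sdiff (measurableSet_singleton (0 : ℝ)) hg.integrable.integrableOn,
          hzero, zero_add]
    _ = ∫ x in s, g x ∂(puncture F) := by
        rw [puncture, Measure.restrict_restrict hs, Set.sdiff_eq]
    _ = ∫ x in s, (ENNReal.ofReal (scoreTail F g x / x)).toReal • g x := by
        rw [hg.puncture_eq, setIntegral_withDensity_eq_setIntegral_toReal_smul
          hg.measurable_scoreTail_div.ennreal_ofReal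
          (Eventually.of_forall fun _ => ENNReal.ofReal_lt_top) g hs]
    _ = ∫ x in s, g x * (scoreTail F g x / x) := by
        refine integral_congr_ae (ae_restrict_of_ae ?_)
        filter_upwards [hg.ae_scoreTail_div_nonneg] with x hx
        rw [ENNReal.toReal_ofReal hx, smul_eq_mul, mul_comm]

lemma IsWeakScaleScore.scoreTail_sub (a b : ℝ) :
    scoreTail F g b - scoreTail F g a = ∫ x in a..b, -(g x * (scoreTail F g x / x)) := by
  have hi := hg.integrable_mul_scoreTail_div
  rw [intervalIntegral.integral_neg,
    ← intervalIntegral.integral_Ici_sub_Ici' hi.integrableOn hi.integrableOn,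
    ← hg.setIntegral_eq measurableSet_Ici, ← hg.setIntegral_eq measurableSet_Ici, neg_sub]
  rfl

lemma IsWeakScaleScore.absolutelyContinuousOnLine_scoreTail :
    AbsolutelyContinuousOnLine (scoreTail F g) :=
  absolutelyContinuousOnLine_of_integral hg.integrable_mul_scoreTail_div.neg hg.scoreTail_sub

lemma IsWeakScaleScore.mul_scoreTail_nonneg (x : ℝ) : 0 ≤ x * scoreTail F g x := by
  have hclosed : IsClosed {x | 0 ≤ x * scoreTail F g x} := isClosed_le continuous_const
    (continuous_id.mul hg.absolutelyContinuousOnLine_scoreTail.continuous)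
  have hae : ∀ᵐ x, 0 ≤ x * scoreTail F g x := by
    filter_upwards [hg.ae_scoreTail_div_nonneg] with x hx
    rwa [mul_comm, mul_nonneg_iff, ← div_nonneg_iff]
  exact hclosed.closure_subset (Measure.dense_of_ae hae x)

lemma IsWeakScaleScore.mul_scoreTail_div (x : ℝ) :
    x * (scoreTail F g x / x) = scoreTail F g x := by
  rcases eq_or_ne x 0 with rfl | hx
  · rw [zero_mul, eq_zero_of_mul_nonneg hg.absolutelyContinuousOnLine_scoreTail.continuous
      hg.mul_scoreTail_nonneg]
  · exact mul_div_cancel₀ _ hx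

lemma IsWeakScaleScore.isScaleDensity : IsScaleDensity F fun x => scoreTail F g x / x where
  measurable := hg.measurable_scoreTail_div
  nonneg x := div_nonneg_iff.2 (mul_nonneg_iff.1 ((mul_comm x _).subst (hg.mul_scoreTail_nonneg x)))
  density := hg.puncture_eq
  absCont := by simpa only [hg.mul_scoreTail_div] using hg.absolutelyContinuousOnLine_scoreTail

lemma IsWeakScaleScore.scaleScore_ae_eq :
    ∀ᵐ x ∂(puncture F), scaleScore (fun x => scoreTail F g x / x) x = g x := by
  have hderiv := ae_hasDerivAt_of_integral hg.integrable_mul_scoreTail_div.neg hg.scoreTail_sub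
  rw [hg.puncture_eq, ae_withDensity_iff
    hg.measurable_scoreTail_div.ennreal_ofReal]
  filter_upwards [hderiv, Measure.ae_ne volume (0 : ℝ)] with x hx hx0 hpos
  have hne : scoreTail F g x / x ≠ 0 := fun h => hpos (by rw [h, ENNReal.ofReal_zero])
  simp only [scaleScore, if_neg hx0, hg.mul_scoreTail_div, hx.deriv, Pi.neg_apply, neg_neg,
    mul_div_cancel_right₀ _ hne]

lemma IsWeakScaleScore.memLp_scaleScore :
    MemLp (scaleScore fun x => scoreTail F g x / x) 2 F :=
  (memLp_puncture_iff (k := scaleScore _) (if_pos rfl)).1 ((memLp_congr_ae hg.scaleScore_ae_eq).2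
    (hg.memLp.mono_measure Measure.restrict_le_self))

end Density

section Uniqueness

variable {F : Measure ℝ} {f f₁ f₂ : ℝ → ℝ}

lemma IsScaleDensity.mul_eq_mul (h₁ : IsScaleDensity F f₁) (h₂ : IsScaleDensity F f₂) (x : ℝ) :
    x * f₁ x = x * f₂ x := by
  have hae : (fun x => ENNReal.ofReal (f₁ x)) =ᵐ[volume] fun x => ENNReal.ofReal (f₂ x) :=
    (withDensity_eq_iff_of_sigmaFinite h₁.measurable.ennreal_ofReal.aemeasurable
      h₂.measurable.ennreal_ofReal.aemeasurable).1 (h₁.density.symm.trans h₂.density)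
  refine congrFun ((Continuous.ae_eq_iff_eq (μ := (volume : Measure ℝ)) h₁.absCont.continuous
    h₂.absCont.continuous).1 ?_) x
  filter_upwards [hae] with y hy
  rw [(ENNReal.ofReal_eq_ofReal_iff (h₁.nonneg y) (h₂.nonneg y)).1 hy]

lemma IsScaleDensity.scaleScore_eq (h₁ : IsScaleDensity F f₁) (h₂ : IsScaleDensity F f₂) :
    scaleScore f₁ = scaleScore f₂ := by
  ext x
  simp only [scaleScore, h₁.mul_eq_mul h₂]
  split_ifs with hx
  · rfl
  · rw [mul_left_cancel₀ hx (h₁.mul_eq_mul h₂ x)]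

lemma exists_isScaleDensity [IsFiniteMeasure F] (hF : fisherInfoScale F < ∞) :
    ∃ f, IsScaleDensity F f := by
  obtain ⟨g, hg⟩ := exists_isWeakScaleScore hF
  exact ⟨_, hg.isScaleDensity⟩

lemma IsScaleDensity.memLp_scaleScore [IsFiniteMeasure F] (hf : IsScaleDensity F f)
    (hF : fisherInfoScale F < ∞) : MemLp (scaleScore f) 2 F := by
  obtain ⟨g, hg⟩ := exists_isWeakScaleScore hF
  rw [hf.scaleScore_eq hg.isScaleDensity]
  exact hg.memLp_scaleScore

end Uniqueness

/-! ### Square roots of absolutely continuous functions -/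

section Sqrt

lemma lipschitzOnWith_sqrt_add {ε : ℝ} (hε : 0 < ε) :
    LipschitzOnWith (Real.toNNReal (1 / √ε)) (fun y => √(y + ε)) (Set.Ici 0) := by
  refine LipschitzOnWith.of_dist_le_mul fun x (hx : 0 ≤ x) y (hy : 0 ≤ y) => ?_
  have hdiff : x - y = (√(x + ε) - √(y + ε)) * (√(x + ε) + √(y + ε)) := by
    rw [mul_comm, ← sq_sub_sq, Real.sq_sqrt (by positivity), Real.sq_sqrt (by positivity)]
    ring
  have hle : √ε ≤ √(x + ε) := Real.sqrt_le_sqrt (by linarith)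
  rw [Real.coe_toNNReal _ (by positivity), Real.dist_eq, Real.dist_eq, div_mul_eq_mul_div, one_mul,
    le_div_iff₀ (by positivity), hdiff, abs_mul, abs_of_nonneg (by positivity : 0 ≤ √_ + √_)]
  gcongr
  linarith [Real.sqrt_nonneg (y + ε)]

lemma absolutelyContinuousOnInterval_comp {m G : ℝ → ℝ} {K : NNReal} {s : Set ℝ} {a b : ℝ}
    (hG : LipschitzOnWith K G s) (hm : AbsolutelyContinuousOnInterval m a b)
    (hs : Set.MapsTo m (Set.uIcc a b) s) :
    AbsolutelyContinuousOnInterval (fun x => G (m x)) a b := by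
  refine squeeze_zero' (Eventually.of_forall fun E => Finset.sum_nonneg fun i _ => dist_nonneg) ?_
    (by simpa only [mul_zero] using Tendsto.const_mul (K : ℝ) hm)
  filter_upwards [mem_inf_of_right (mem_principal_self _)] with E hE
  rw [Finset.mul_sum]
  exact Finset.sum_le_sum fun i hi =>
    hG.dist_le_mul _ (hs (hE.1 i hi).1) _ (hs (hE.1 i hi).2)

variable {m : ℝ → ℝ} {a b : ℝ}

lemma enorm_deriv_sqrt_add_le {s : Set ℝ} {x ε : ℝ} (hε : 0 < ε) (hs : s ∈ 𝓝 x)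
    (hnn : ∀ y ∈ s, 0 ≤ m y) (hd : DifferentiableAt ℝ m x) :
    ‖deriv (fun y => √(m y + ε)) x‖ₑ ≤ ‖deriv m x / (2 * √(m x))‖ₑ := by
  have hx := hnn x (mem_of_mem_nhds hs)
  rw [((hd.hasDerivAt.add_const ε).sqrt (by positivity)).deriv, enorm_le_iff_norm_le]
  rcases hx.eq_or_lt with h0 | hpos
  · have hmin : IsLocalMin m x := by
      filter_upwards [hs] with y hy
      exact h0 ▸ hnn y hy
    simp [hmin.deriv_eq_zero]
  · rw [norm_div, norm_div, Real.norm_of_nonneg (by positivity : 0 ≤ 2 * √(m x + ε)),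
      Real.norm_of_nonneg (by positivity : 0 ≤ 2 * √(m x))]
    gcongr
    linarith

lemma enorm_sqrt_sub_sqrt_le (hab : a ≤ b) (hac : AbsolutelyContinuousOnInterval m a b)
    (hnn : ∀ x ∈ Set.Icc a b, 0 ≤ m x) :
    ‖√(m b) - √(m a)‖ₑ ≤ ∫⁻ x in Set.Ioo a b, ‖deriv m x / (2 * √(m x))‖ₑ := by
  have hle : ∀ ε : ℝ, 0 < ε →
      ‖√(m b + ε) - √(m a + ε)‖ₑ ≤ ∫⁻ x in Set.Ioo a b, ‖deriv m x / (2 * √(m x))‖ₑ := by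
    intro ε hε
    have hmaps : Set.MapsTo m (Set.uIcc a b) (Set.Ici 0) := by rwa [Set.uIcc_of_le hab]
    have hsqrt : AbsolutelyContinuousOnInterval (fun x => √(m x + ε)) a b :=
      absolutelyContinuousOnInterval_comp (G := fun y => √(y + ε)) (lipschitzOnWith_sqrt_add hε)
        hac hmaps
    rw [← hsqrt.integral_deriv_eq_sub, intervalIntegral.integral_of_le hab,
      integral_Ioc_eq_integral_Ioo]
    refine (enorm_integral_le_lintegral_enorm _).trans (lintegral_mono_ae ?_)
    refine (ae_restrict_iff' measurableSet_Ioo).2 ?_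
    filter_upwards [hac.ae_differentiableAt] with x hd hx
    exact enorm_deriv_sqrt_add_le hε (Icc_mem_nhds hx.1 hx.2) hnn
      (hd (Set.Icc_subset_uIcc (Set.Ioo_subset_Icc_self hx)))
  have hlim : Tendsto (fun ε : ℝ => ‖√(m b + ε) - √(m a + ε)‖ₑ) (𝓝[>] 0)
      (𝓝 ‖√(m b) - √(m a)‖ₑ) := by
    have hcont : Continuous fun ε : ℝ => ‖√(m b + ε) - √(m a + ε)‖ₑ := by fun_prop
    simpa only [add_zero] using (hcont.tendsto 0).mono_left nhdsWithin_le_nhds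
  exact le_of_tendsto hlim (eventually_mem_nhdsWithin.mono hle)

end Sqrt

/-! ### An integral inequality on the half-line -/

section HalfLine

lemma sq_lintegral_mul_le {α : Type*} [MeasurableSpace α] {μ : Measure α} {f g : α → ℝ≥0∞}
    (hf : AEMeasurable f μ) (hg : AEMeasurable g μ) :
    (∫⁻ x, f x * g x ∂μ) ^ 2 ≤ (∫⁻ x, f x ^ 2 ∂μ) * ∫⁻ x, g x ^ 2 ∂μ := by
  refine (pow_le_pow_left' (ENNReal.lintegral_mul_le_Lp_mul_Lq μ Real.HolderConjugate.two_two
    hf hg) 2).trans_eq ?_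
  simp only [mul_pow, ← ENNReal.rpow_two, ← ENNReal.rpow_mul]
  simp only [one_div, inv_mul_cancel₀ (two_ne_zero (α := ℝ)), ENNReal.rpow_one]

lemma lintegral_Ioo_inv_sq {a b : ℝ} (ha : 0 < a) (hab : a ≤ b) :
    ∫⁻ x in Set.Ioo a b, ENNReal.ofReal x⁻¹ ^ 2 = ENNReal.ofReal (a⁻¹ - b⁻¹) := by
  have hne : ∀ x ∈ Set.uIcc a b, x ≠ 0 := fun x hx =>
    (ha.trans_le (Set.uIcc_of_le hab ▸ hx).1).ne'
  have hcont : ContinuousOn (fun x : ℝ => x⁻¹ ^ 2) (Set.uIcc a b) :=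
    (continuousOn_inv₀.mono hne).pow 2
  have hFTC : ∫ x in a..b, x⁻¹ ^ 2 = a⁻¹ - b⁻¹ := by
    rw [intervalIntegral.integral_eq_sub_of_hasDerivAt (f := fun x => -x⁻¹) (fun x hx => ?_)
      hcont.intervalIntegrable]
    · ring
    · simpa only [inv_pow, neg_neg] using (hasDerivAt_inv (hne x hx)).fun_neg
  rw [← hFTC, intervalIntegral.integral_of_le hab, integral_Ioc_eq_integral_Ioo,
    ofReal_integral_eq_lintegral_ofReal
      (hcont.intervalIntegrable.1.mono_set Set.Ioo_subset_Ioc_self)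
      (Eventually.of_forall fun x => sq_nonneg _)]
  refine setLIntegral_congr_fun measurableSet_Ioo fun x hx => ?_
  exact (ENNReal.ofReal_pow (inv_nonneg.2 (ha.trans hx.1).le) 2).symm

variable {K G : ℝ → ℝ≥0∞}

lemma sq_lintegral_Ioo_le (hK : Measurable K) {a b : ℝ} (ha : 0 < a) (hab : a ≤ b) :
    (∫⁻ y in Set.Ioo a b, K y) ^ 2 ≤
      ENNReal.ofReal (a⁻¹ - b⁻¹) * ∫⁻ y in Set.Ioo a b, (ENNReal.ofReal y * K y) ^ 2 := by
  have hweight : ∫⁻ y in Set.Ioo a b, K y =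
      ∫⁻ y in Set.Ioo a b, ENNReal.ofReal y⁻¹ * (ENNReal.ofReal y * K y) := by
    refine setLIntegral_congr_fun measurableSet_Ioo fun y hy => ?_
    have hy0 : 0 < y := ha.trans hy.1
    simp only [← mul_assoc, ← ENNReal.ofReal_mul (inv_nonneg.2 hy0.le), inv_mul_cancel₀ hy0.ne',
      ENNReal.ofReal_one, one_mul]
  rw [hweight, ← lintegral_Ioo_inv_sq ha hab]
  exact sq_lintegral_mul_le (by fun_prop) (by fun_prop)

lemma lintegral_Ioi_mul_lintegral_Ioo_div (hK : Measurable K) (hG : Measurable G) {s t : ℝ}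
    (hs : 0 < s) (ht : 0 < t) :
    ∫⁻ x in Set.Ioi 0, K x * ∫⁻ y in Set.Ioo (x / t) (x / s), G y =
      ∫⁻ y in Set.Ioi 0, G y * ∫⁻ x in Set.Ioo (s * y) (t * y), K x := by
  let H : ℝ × ℝ → ℝ≥0∞ := {p : ℝ × ℝ | 0 < p.1 ∧ p.1 / t < p.2 ∧ p.2 < p.1 / s}.indicator
    fun p => K p.1 * G p.2
  have hH : Measurable H := Measurable.indicator (by fun_prop)
    ((measurableSet_lt measurable_const measurable_fst).inter
      ((measurableSet_lt (measurable_fst.div_const t) measurable_snd).inter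
        (measurableSet_lt measurable_snd (measurable_fst.div_const s))))
  have hfst : ∀ x, (Set.Ioi 0).indicator
      (fun x => K x * ∫⁻ y in Set.Ioo (x / t) (x / s), G y) x = ∫⁻ y, H (x, y) := fun x => by
    by_cases hx : 0 < x
    · rw [Set.indicator_of_mem (Set.mem_Ioi.2 hx), ← lintegral_const_mul _ hG,
        ← lintegral_indicator measurableSet_Ioo]
      simp only [H, Set.indicator, Set.mem_ofPred_eq, Set.mem_Ioo, hx, true_and]
    · simp [H, hx]
  have hsnd : ∀ y, (Set.Ioi 0).indicator
      (fun y => G y * ∫⁻ x in Set.Ioo (s * y) (t * y), K x) y = ∫⁻ x, H (x, y) := fun y => by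
    have hmem : ∀ x, (0 < x ∧ x / t < y ∧ y < x / s) ↔ 0 < y ∧ x ∈ Set.Ioo (s * y) (t * y) := by
      intro x
      rw [div_lt_iff₀' ht, lt_div_iff₀' hs, Set.mem_Ioo]
      constructor
      · rintro ⟨hx, hxt, hxs⟩
        exact ⟨pos_of_mul_pos_right (hx.trans hxt) ht.le, hxs, hxt⟩
      · rintro ⟨hy, hxs, hxt⟩
        exact ⟨(mul_pos hs hy).trans hxs, hxt, hxs⟩
    by_cases hy : 0 < y
    · rw [Set.indicator_of_mem (Set.mem_Ioi.2 hy), ← lintegral_const_mul _ hK,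
        ← lintegral_indicator measurableSet_Ioo]
      simp only [H, Set.indicator, Set.mem_ofPred_eq, hmem, hy, true_and, mul_comm]
    · simp [H, hmem, hy]
  rw [← lintegral_indicator measurableSet_Ioi, ← lintegral_indicator measurableSet_Ioi,
    lintegral_congr hfst, lintegral_congr hsnd]
  exact lintegral_lintegral_swap hH.aemeasurable

lemma lintegral_Ioi_sq_lintegral_Ioo_div_le (hK : Measurable K) {s t : ℝ} (hs : 0 < s)
    (hst : s ≤ t) :
    ∫⁻ x in Set.Ioi 0, ENNReal.ofReal x⁻¹ * (∫⁻ y in Set.Ioo (x / t) (x / s), K y) ^ 2 ≤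
      ENNReal.ofReal ((t - s) ^ 2 / (s * t)) *
        ∫⁻ y in Set.Ioi 0, ENNReal.ofReal y * K y ^ 2 := by
  have ht : 0 < t := hs.trans_le hst
  have hts : 0 ≤ t - s := sub_nonneg.2 hst
  have hx : ∀ x ∈ Set.Ioi (0 : ℝ),
      ENNReal.ofReal x⁻¹ * (∫⁻ y in Set.Ioo (x / t) (x / s), K y) ^ 2 ≤
        ENNReal.ofReal (t - s) * ENNReal.ofReal x⁻¹ ^ 2 *
          ∫⁻ y in Set.Ioo (x / t) (x / s), (ENNReal.ofReal y * K y) ^ 2 := fun x (hx : 0 < x) => by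
    refine (mul_le_mul_right (sq_lintegral_Ioo_le hK (by positivity) (by gcongr)) _).trans_eq ?_
    rw [inv_div, inv_div, ← sub_div, div_eq_mul_inv, ENNReal.ofReal_mul hts]
    ring
  have hy : ∀ y ∈ Set.Ioi (0 : ℝ), (ENNReal.ofReal y * K y) ^ 2 *
      ∫⁻ x in Set.Ioo (s * y) (t * y), ENNReal.ofReal (t - s) * ENNReal.ofReal x⁻¹ ^ 2 =
        ENNReal.ofReal ((t - s) ^ 2 / (s * t)) * (ENNReal.ofReal y * K y ^ 2) :=
      fun y (hy : 0 < y) => by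
    have hreal : y ^ 2 * ((t - s) * ((s * y)⁻¹ - (t * y)⁻¹)) = (t - s) ^ 2 / (s * t) * y := by
      field_simp
    rw [lintegral_const_mul _ (by fun_prop), lintegral_Ioo_inv_sq (by positivity) (by gcongr),
      ← ENNReal.ofReal_mul hts, mul_pow, ← ENNReal.ofReal_pow hy.le, mul_right_comm,
      ← ENNReal.ofReal_mul (by positivity), hreal, ENNReal.ofReal_mul (by positivity), mul_assoc]
  calc _ ≤ _ := setLIntegral_mono' measurableSet_Ioi hx
    _ = _ := lintegral_Ioi_mul_lintegral_Ioo_div (by fun_prop) (by fun_prop) hs ht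
    _ = _ := setLIntegral_congr_fun measurableSet_Ioi hy
    _ = _ := lintegral_const_mul _ (by fun_prop)

end HalfLine

/-! ### Convergence in quadratic mean -/

section QuadraticMean

lemma tendsto_zero_of_add_le {ι : Type*} {l : Filter ι} {N P a : ι → ℝ≥0∞} {A : ℝ≥0∞}
    (hA : A ≠ ∞) (hle : ∀ᶠ i in l, N i + P i ≤ a i) (ha : Tendsto a l (𝓝 A))
    (hP : A ≤ liminf P l) : Tendsto N l (𝓝 0) := by
  have hmin : Tendsto (fun i => min (P i) A) l (𝓝 A) := by
    refine tendsto_order.2 ⟨fun b hb => ?_, fun b hb => ?_⟩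
    · exact (eventually_lt_of_lt_liminf (hb.trans_le hP)).mono fun i hi => lt_min hi hb
    · exact Eventually.of_forall fun i => (min_le_right _ _).trans_lt hb
  have hsub : Tendsto (fun i => a i - min (P i) A) l (𝓝 0) := by
    simpa only [tsub_self] using ENNReal.Tendsto.sub ha hmin (Or.inl hA)
  refine tendsto_of_tendsto_of_tendsto_of_le_of_le' tendsto_const_nhds hsub
    (Eventually.of_forall fun i => zero_le) ?_
  filter_upwards [hle] with i hi
  refine ENNReal.le_sub_of_add_le_right (ne_top_of_le_ne_top hA (min_le_right _ _)) ?_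
  exact (add_le_add_right (min_le_left _ _) _).trans hi

variable {α E ι : Type*} [MeasurableSpace α] {μ : Measure α} [NormedAddCommGroup E]

lemma eLpNorm_two_sq (u : α → E) (μ : Measure α) : eLpNorm u 2 μ ^ 2 = ∫⁻ x, ‖u x‖ₑ ^ 2 ∂μ := by
  simpa only [ENNReal.coe_ofNat, NNReal.coe_ofNat, ENNReal.rpow_two] using
    eLpNorm_nnreal_pow_eq_lintegral (f := u) (μ := μ) (p := 2) two_ne_zero

lemma eLpNorm_two_sq_le_liminf {l : Filter ι} [l.IsCountablyGenerated] {w : ι → α → E}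
    {v : α → E} (hw : ∀ i, AEStronglyMeasurable (w i) μ)
    (hlim : ∀ᵐ x ∂μ, v x ≠ 0 → Tendsto (w · x) l (𝓝 (v x))) :
    eLpNorm v 2 μ ^ 2 ≤ liminf (fun i => eLpNorm (w i) 2 μ ^ 2) l := by
  rcases l.eq_or_neBot with rfl | hl
  · simp only [liminf_bot, le_top]
  simp only [eLpNorm_two_sq]
  refine (lintegral_mono_ae ?_).trans (lintegral_liminf_le' fun i => (hw i).enorm.pow_const 2)
  filter_upwards [hlim] with x hx
  rcases eq_or_ne (v x) 0 with h0 | h0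
  · simp [h0]
  · exact (((ENNReal.continuous_pow 2).tendsto _).comp (hx h0).enorm).liminf_eq.ge

variable {H : Type*} [NormedAddCommGroup H] [InnerProductSpace ℝ H]

lemma enorm_sub_sq_add_enorm_add_sq (x y : H) :
    ‖x - y‖ₑ ^ 2 + ‖x + y‖ₑ ^ 2 = 2 * (‖x‖ₑ ^ 2 + ‖y‖ₑ ^ 2) := by
  rw [add_comm (‖x - y‖ₑ ^ 2)]
  simp only [enorm_eq_nnnorm]
  exact_mod_cast parallelogram_law_with_nnnorm ℝ x y

lemma eLpNorm_sub_sq_add_eLpNorm_add_sq {u v : α → H} (hu : AEStronglyMeasurable u μ)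
    (hv : AEStronglyMeasurable v μ) :
    eLpNorm (u - v) 2 μ ^ 2 + eLpNorm (u + v) 2 μ ^ 2 =
      2 * (eLpNorm u 2 μ ^ 2 + eLpNorm v 2 μ ^ 2) := by
  simp only [eLpNorm_two_sq]
  rw [← lintegral_add_left' ((hu.sub hv).enorm.pow_const 2),
    ← lintegral_add_left' (hu.enorm.pow_const 2),
    ← lintegral_const_mul' _ _ ENNReal.ofNat_ne_top]
  exact lintegral_congr fun x => enorm_sub_sq_add_enorm_add_sq (u x) (v x)

lemma tendsto_eLpNorm_sub_zero {l : Filter ι} [l.IsCountablyGenerated] {u : ι → α → H}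
    {v : α → H} {c : ι → ℝ≥0∞} (hu : ∀ i, AEStronglyMeasurable (u i) μ) (hv : MemLp v 2 μ)
    (hle : ∀ᶠ i in l, eLpNorm (u i) 2 μ ^ 2 ≤ c i) (hc : Tendsto c l (𝓝 (eLpNorm v 2 μ ^ 2)))
    (hlim : ∀ᵐ x ∂μ, v x ≠ 0 → Tendsto (u · x) l (𝓝 (v x))) :
    Tendsto (fun i => eLpNorm (u i - v) 2 μ) l (𝓝 0) := by
  have hdouble : eLpNorm (v + v) 2 μ ^ 2 = 2 * (eLpNorm v 2 μ ^ 2 + eLpNorm v 2 μ ^ 2) := by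
    simpa using eLpNorm_sub_sq_add_eLpNorm_add_sq hv.1 hv.1
  have hliminf : eLpNorm (v + v) 2 μ ^ 2 ≤ liminf (fun i => eLpNorm (u i + v) 2 μ ^ 2) l := by
    refine eLpNorm_two_sq_le_liminf (fun i => (hu i).add hv.1) ?_
    filter_upwards [hlim] with x hx hne
    exact (hx fun h0 => hne (by simp [h0])).add_const (v x)
  have hsq : Tendsto (fun i => eLpNorm (u i - v) 2 μ ^ 2) l (𝓝 0) := by
    refine tendsto_zero_of_add_le (A := eLpNorm (v + v) 2 μ ^ 2) (ENNReal.pow_ne_top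
      (hv.add hv).2.ne) (hle.mono fun i hi => ?_) (hdouble ▸ ENNReal.Tendsto.const_mul
      (hc.add_const _) (Or.inr ENNReal.ofNat_ne_top)) hliminf
    rw [eLpNorm_sub_sq_add_eLpNorm_add_sq (hu i) hv.1]
    gcongr
  simpa only [Function.comp_def, ENNReal.pow_rpow_inv_natCast two_ne_zero,
    ENNReal.zero_rpow_of_pos (by positivity : (0 : ℝ) < ((2 : ℕ) : ℝ)⁻¹)] using
    ((ENNReal.continuous_rpow_const (y := ((2 : ℕ) : ℝ)⁻¹)).tendsto 0).comp hsq

end QuadraticMean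

/-! ### Square roots of measures -/

section SqrtMeasureDist

lemma enorm_sqrt_sq (a : ℝ) : ‖√a‖ₑ ^ 2 = ENNReal.ofReal a := by
  rw [Real.enorm_of_nonneg (Real.sqrt_nonneg _), ← ENNReal.ofReal_pow (Real.sqrt_nonneg _),
    Real.sq_sqrt', ENNReal.ofReal_max, ENNReal.ofReal_zero, max_eq_left zero_le]

variable {κ P Q : Measure ℝ} {g : ℝ → ℝ}

lemma sqrtMeasureDist_eq [SigmaFinite κ] [SigmaFinite P] [SigmaFinite Q] (hQ : Q ≪ κ)
    (hP : P ≪ κ) (hg : Measurable g) :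
    sqrtMeasureDist Q P g = eLpNorm
      (fun x => √(Q.rnDeriv κ x).toReal - √(P.rnDeriv κ x).toReal * g x) 2 κ := by
  refine (ENNReal.pow_right_strictMono two_ne_zero).injective ?_
  simp only [sqrtMeasureDist, eLpNorm_two_sq]
  rw [← lintegral_rnDeriv_mul (hQ.add_left hP) (by fun_prop)]
  refine lintegral_congr_ae ?_
  filter_upwards [Measure.rnDeriv_mul_rnDeriv (κ := κ) (Measure.le_add_right le_rfl :
      Q ≤ Q + P).absolutelyContinuous, Measure.rnDeriv_mul_rnDeriv (κ := κ)
      (Measure.le_add_left le_rfl : P ≤ Q + P).absolutelyContinuous,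
    Measure.rnDeriv_ne_top (Q + P) κ] with x hQx hPx htop
  rw [← hQx, ← hPx, Pi.mul_apply, Pi.mul_apply, ENNReal.toReal_mul, ENNReal.toReal_mul,
    Real.sqrt_mul ENNReal.toReal_nonneg, Real.sqrt_mul ENNReal.toReal_nonneg, mul_right_comm,
    ← sub_mul, enorm_mul, mul_pow, enorm_sqrt_sq, ENNReal.ofReal_toReal htop, mul_comm]

lemma sqrtMeasureDist_withDensity [SigmaFinite κ] {p q : ℝ → ℝ} (hp : Measurable p)
    (hq : Measurable q) (hp0 : ∀ x, 0 ≤ p x) (hq0 : ∀ x, 0 ≤ q x) (hg : Measurable g) :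
    sqrtMeasureDist (κ.withDensity fun x => ENNReal.ofReal (q x))
        (κ.withDensity fun x => ENNReal.ofReal (p x)) g =
      eLpNorm (fun x => √(q x) - √(p x) * g x) 2 κ := by
  rw [sqrtMeasureDist_eq (withDensity_absolutelyContinuous _ _)
    (withDensity_absolutelyContinuous _ _) hg]
  refine eLpNorm_congr_ae ?_
  filter_upwards [Measure.rnDeriv_withDensity κ hp.ennreal_ofReal,
    Measure.rnDeriv_withDensity κ hq.ennreal_ofReal] with x hpx hqx
  rw [hpx, hqx, ENNReal.toReal_ofReal (hp0 x), ENNReal.toReal_ofReal (hq0 x)]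

lemma eLpNorm_two_dirac_add {α E : Type*} [MeasurableSpace α] [MeasurableSingletonClass α]
    [NormedAddCommGroup E] {u : α → E} {a : α} (hu : u a = 0) (μ : Measure α) :
    eLpNorm u 2 (Measure.dirac a + μ) = eLpNorm u 2 μ := by
  refine (ENNReal.pow_right_strictMono two_ne_zero).injective ?_
  simp [eLpNorm_two_sq, hu]

end SqrtMeasureDist

/-! ### The scale family of a density -/

section ScaleFamily

variable {F : Measure ℝ} {f : ℝ → ℝ} {σ τ : ℝ}

lemma lintegral_eq_lintegral_Ioi_add_neg (G : ℝ → ℝ≥0∞) :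
    ∫⁻ x, G x = (∫⁻ x in Set.Ioi 0, G x) + ∫⁻ x in Set.Ioi 0, G (-x) := by
  have hneg := (Measure.measurePreserving_neg (volume : Measure ℝ)).setLIntegral_comp_preimage_emb
    (MeasurableEquiv.neg ℝ).measurableEmbedding G (Set.Iio 0)
  simp only [Set.neg_preimage, Set.neg_Iio, neg_zero] at hneg
  rw [hneg, setLIntegral_congr Iio_ae_eq_Iic, ← Set.compl_Ioi,
    lintegral_add_compl G measurableSet_Ioi]

lemma lintegral_comp_mul_left (G : ℝ → ℝ≥0∞) {c : ℝ} (hc : c ≠ 0) :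
    ∫⁻ x, G (c * x) = ENNReal.ofReal |c⁻¹| * ∫⁻ x, G x := by
  rw [← smul_eq_mul, ← lintegral_smul_measure, ← Real.map_volume_mul_left hc,
    (measurableEmbedding_mulLeft₀ hc).lintegral_map]

lemma map_mul_left_withDensity (G : ℝ → ℝ≥0∞) (hσ : 0 < σ) :
    (volume.withDensity G).map (fun x => σ * x) =
      volume.withDensity fun x => ENNReal.ofReal σ⁻¹ * G (x / σ) := by
  have hemb := measurableEmbedding_mulLeft₀ hσ.ne'
  ext A hA
  rw [Measure.map_apply hemb.measurable hA, withDensity_apply _ (hemb.measurable hA),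
    withDensity_apply _ hA, lintegral_const_mul' _ _ ENNReal.ofReal_ne_top,
    ← abs_of_pos (inv_pos.2 hσ), ← smul_eq_mul, ← lintegral_smul_measure, ← Measure.restrict_smul,
    ← Real.map_volume_mul_left hσ.ne', hemb.restrict_map, hemb.lintegral_map]
  simp only [mul_div_cancel_left₀ _ hσ.ne']

lemma ae_comp_div {p : ℝ → Prop} (hp : ∀ᵐ x, p x) (hσ : σ ≠ 0) : ∀ᵐ x, p (x / σ) := by
  simpa only [smul_eq_mul, ← div_eq_inv_mul] using
    (Measure.quasiMeasurePreserving_smul volume (inv_ne_zero hσ)).ae hp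

/-- The density of the law of `σ X` with respect to `δ₀ + volume`, where `F` is the law of `X` and
`f` is a Lebesgue density of `F` off zero. -/
noncomputable def scaledDensity (F : Measure ℝ) (f : ℝ → ℝ) (σ x : ℝ) : ℝ :=
  if x = 0 then F.real {0} else f (x / σ) / σ

lemma measurable_scaledDensity (F : Measure ℝ) (hf : Measurable f) (σ : ℝ) :
    Measurable (scaledDensity F f σ) :=
  Measurable.ite (measurableSet_singleton 0) measurable_const (by fun_prop)

lemma scaledDensity_nonneg (hf : ∀ x, 0 ≤ f x) (hσ : 0 ≤ σ) (x : ℝ) :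
    0 ≤ scaledDensity F f σ x := by
  unfold scaledDensity
  split_ifs
  · exact measureReal_nonneg
  · exact div_nonneg (hf _) hσ

/-- The square root of the Lebesgue density of the law of `σ X`, where `X` has density `f`. -/
noncomputable def sqrtScaledDensity (f : ℝ → ℝ) (σ x : ℝ) : ℝ :=
  √(f (x / σ) / σ)

@[fun_prop]
lemma measurable_sqrtScaledDensity (hf : Measurable f) (σ : ℝ) :
    Measurable (sqrtScaledDensity f σ) := by
  unfold sqrtScaledDensity
  fun_prop

lemma IsScaleDensity.scaleFamily_eq [IsFiniteMeasure F] (hf : IsScaleDensity F f) (hσ : 0 < σ) :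
    scaleFamily F σ = (Measure.dirac (0 : ℝ) + volume).withDensity
      fun x => ENNReal.ofReal (scaledDensity F f σ x) := by
  have hm : Measurable fun x : ℝ => σ * x := measurable_const_mul σ
  have hsplit : F = F {0} • Measure.dirac 0 + puncture F := by
    rw [← Measure.restrict_singleton, puncture,
      Measure.restrict_add_restrict_compl (measurableSet_singleton 0)]
  have hatom : F {0} = ENNReal.ofReal (scaledDensity F f σ 0) := by simp [scaledDensity]
  rw [withDensity_add_measure, dirac_withDensity, ← hatom, scaleFamily]
  conv_lhs => rw [hsplit]
  rw [Measure.map_add _ _ hm, Measure.map_smul, Measure.map_dirac' hm, mul_zero, hf.density,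
    map_mul_left_withDensity _ hσ]
  congr 1
  refine withDensity_congr_ae ?_
  filter_upwards [Measure.ae_ne volume (0 : ℝ)] with x hx
  rw [scaledDensity, if_neg hx, ← ENNReal.ofReal_mul (inv_nonneg.2 hσ.le), inv_mul_eq_div]

lemma IsScaleDensity.sqrtMeasureDist_scaleFamily [IsFiniteMeasure F] (hf : IsScaleDensity F f)
    (hσ : 0 < σ) (hτ : 0 < τ) {g : ℝ → ℝ} (hg : Measurable g) (hg0 : g 0 = 1) :
    sqrtMeasureDist (scaleFamily F τ) (scaleFamily F σ) g =
      eLpNorm (fun x => sqrtScaledDensity f τ x - sqrtScaledDensity f σ x * g x) 2 volume := by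
  rw [hf.scaleFamily_eq hσ, hf.scaleFamily_eq hτ, sqrtMeasureDist_withDensity
    (measurable_scaledDensity F hf.measurable σ) (measurable_scaledDensity F hf.measurable τ)
    (scaledDensity_nonneg hf.nonneg hσ.le) (scaledDensity_nonneg hf.nonneg hτ.le) hg,
    eLpNorm_two_dirac_add (by simp [scaledDensity, hg0])]
  refine eLpNorm_congr_ae ?_
  filter_upwards [Measure.ae_ne volume (0 : ℝ)] with x hx
  simp only [scaledDensity, if_neg hx, sqrtScaledDensity]

end ScaleFamily

/-! ### The Hellinger distance within a scale family -/

section Hellinger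

variable {f : ℝ → ℝ} {σ τ x : ℝ}

/-- The Fisher information of scale `∫ Λ² f` in terms of the score `Λ` of the density `f`. -/
noncomputable def scoreEnergy (f : ℝ → ℝ) : ℝ≥0∞ :=
  ∫⁻ x, ‖scaleScore f x‖ₑ ^ 2 * ENNReal.ofReal (f x)

lemma scaleScore_comp_neg (f : ℝ → ℝ) (x : ℝ) :
    scaleScore (fun y => f (-y)) x = scaleScore f (-x) := by
  have hderiv : deriv (fun y => y * f (-y)) x = deriv (fun y => y * f y) (-x) := by
    rw [← neg_neg (deriv _ (-x)), ← deriv_comp_neg (fun y => y * f y) x, ← deriv.fun_neg]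
    simp only [neg_mul, neg_neg]
  simp only [scaleScore, hderiv, neg_eq_zero]

lemma sqrtScaledDensity_eq_mul (hx : 0 < x) (σ : ℝ) :
    sqrtScaledDensity f σ x = √x⁻¹ * √(x / σ * f (x / σ)) := by
  rw [← Real.sqrt_mul (inv_nonneg.2 hx.le), sqrtScaledDensity]
  congr 1
  field_simp

lemma ofReal_mul_enorm_deriv_div_sqrt_sq (hf : 0 ≤ f x) (hx : 0 < x) :
    ENNReal.ofReal x * ‖deriv (fun y => y * f y) x / (2 * √(x * f x))‖ₑ ^ 2 =
      ENNReal.ofReal (1 / 4) * (‖scaleScore f x‖ₑ ^ 2 * ENNReal.ofReal (f x)) := by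
  rcases hf.eq_or_lt with h0 | hpos
  · simp [← h0]
  rw [scaleScore, if_neg hx.ne', ← enorm_pow, ← enorm_pow, Real.enorm_of_nonneg (sq_nonneg _),
    Real.enorm_of_nonneg (sq_nonneg _), ← ENNReal.ofReal_mul hx.le,
    ← ENNReal.ofReal_mul (sq_nonneg _), ← ENNReal.ofReal_mul (by norm_num), div_pow, mul_pow,
    Real.sq_sqrt (by positivity)]
  congr 1
  field_simp
  norm_num

lemma setLIntegral_Ioi_enorm_sqrtScaledDensity_sub_sq_le (hf : ∀ x, 0 ≤ f x)
    (hac : AbsolutelyContinuousOnLine fun x => x * f x) (hσ : 0 < σ) (hστ : σ ≤ τ) :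
    ∫⁻ x in Set.Ioi 0, ‖sqrtScaledDensity f σ x - sqrtScaledDensity f τ x‖ₑ ^ 2 ≤
      ENNReal.ofReal ((τ - σ) ^ 2 / (4 * (σ * τ))) *
        ∫⁻ x in Set.Ioi 0, ‖scaleScore f x‖ₑ ^ 2 * ENNReal.ofReal (f x) := by
  let m : ℝ → ℝ := fun y => y * f y
  let K : ℝ → ℝ≥0∞ := fun y => ‖deriv m y / (2 * √(m y))‖ₑ
  have hK : Measurable K :=
    ((measurable_deriv m).div (hac.continuous.measurable.sqrt.const_mul 2)).enorm
  have hx : ∀ x ∈ Set.Ioi (0 : ℝ), ‖sqrtScaledDensity f σ x - sqrtScaledDensity f τ x‖ₑ ^ 2 ≤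
      ENNReal.ofReal x⁻¹ * (∫⁻ y in Set.Ioo (x / τ) (x / σ), K y) ^ 2 := fun x (hx : 0 < x) => by
    rw [sqrtScaledDensity_eq_mul hx, sqrtScaledDensity_eq_mul hx, ← mul_sub, enorm_mul, mul_pow,
      enorm_sqrt_sq]
    gcongr
    refine enorm_sqrt_sub_sqrt_le (m := m) (by gcongr)
      (hac.absolutelyContinuousOnInterval _ _) fun y hy => mul_nonneg ?_ (hf y)
    exact (div_nonneg hx.le (hσ.trans_le hστ).le).trans hy.1
  have hy : ∀ y ∈ Set.Ioi (0 : ℝ), ENNReal.ofReal y * K y ^ 2 =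
      ENNReal.ofReal (1 / 4) * (‖scaleScore f y‖ₑ ^ 2 * ENNReal.ofReal (f y)) :=
    fun y hy => ofReal_mul_enorm_deriv_div_sqrt_sq (hf y) hy
  refine (setLIntegral_mono' measurableSet_Ioi hx).trans
    ((lintegral_Ioi_sq_lintegral_Ioo_div_le hK hσ hστ).trans_eq ?_)
  rw [setLIntegral_congr_fun measurableSet_Ioi hy, lintegral_const_mul' _ _ ENNReal.ofReal_ne_top,
    ← mul_assoc, ← ENNReal.ofReal_mul (by have := hσ.trans_le hστ; positivity)]
  congr 2
  ring

lemma eLpNorm_sqrtScaledDensity_sub_sq_le (hf : ∀ x, 0 ≤ f x)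
    (hac : AbsolutelyContinuousOnLine fun x => x * f x) (hσ : 0 < σ) (hτ : 0 < τ) :
    eLpNorm (sqrtScaledDensity f σ - sqrtScaledDensity f τ) 2 volume ^ 2 ≤
      ENNReal.ofReal ((τ - σ) ^ 2 / (4 * (σ * τ))) * scoreEnergy f := by
  wlog hστ : σ ≤ τ generalizing σ τ
  · rw [eLpNorm_sub_comm, mul_comm σ, ← neg_sub σ, neg_sq]
    exact this hτ hσ (le_of_not_ge hστ)
  have hac_neg : AbsolutelyContinuousOnLine fun x => x * f (-x) := by
    simpa only [neg_mul, neg_neg] using hac.neg_comp_neg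
  rw [eLpNorm_two_sq, scoreEnergy, lintegral_eq_lintegral_Ioi_add_neg,
    lintegral_eq_lintegral_Ioi_add_neg fun x => ‖scaleScore f x‖ₑ ^ 2 * _, mul_add]
  refine add_le_add (setLIntegral_Ioi_enorm_sqrtScaledDensity_sub_sq_le hf hac hσ hστ) ?_
  simpa only [scaleScore_comp_neg, sqrtScaledDensity, neg_div, Pi.sub_apply] using
    setLIntegral_Ioi_enorm_sqrtScaledDensity_sub_sq_le (fun x => hf (-x)) hac_neg hσ hστ

end Hellinger

/-! ### Differentiability of the scale family -/

section Differentiability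

variable {F : Measure ℝ} {f : ℝ → ℝ} {σ t x : ℝ}

/-- The derivative `Λ_σ √f_σ / 2` of `σ ↦ √f_σ`. -/
noncomputable def sqrtScaledDensityDeriv (f : ℝ → ℝ) (σ x : ℝ) : ℝ :=
  scaleScoreAt f σ x / 2 * sqrtScaledDensity f σ x

@[fun_prop]
lemma measurable_scaleScoreAt (hf : Measurable f) (σ : ℝ) : Measurable (scaleScoreAt f σ) :=
  ((measurable_scaleScore hf).comp (measurable_id.div_const σ)).const_mul σ⁻¹

lemma eLpNorm_sqrtScaledDensityDeriv_sq (f : ℝ → ℝ) (hσ : 0 < σ) :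
    eLpNorm (sqrtScaledDensityDeriv f σ) 2 volume ^ 2 =
      ENNReal.ofReal (1 / (4 * σ ^ 2)) * scoreEnergy f := by
  have hx : ∀ x, ‖sqrtScaledDensityDeriv f σ x‖ₑ ^ 2 = ENNReal.ofReal ((σ⁻¹ / 2) ^ 2 * σ⁻¹) *
      (‖scaleScore f (σ⁻¹ * x)‖ₑ ^ 2 * ENNReal.ofReal (f (σ⁻¹ * x))) := fun x => by
    rw [sqrtScaledDensityDeriv, scaleScoreAt, sqrtScaledDensity, enorm_mul, mul_pow, enorm_sqrt_sq,
      mul_div_right_comm, enorm_mul, mul_pow, ← enorm_pow, Real.enorm_of_nonneg (sq_nonneg _),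
      ENNReal.ofReal_mul (sq_nonneg _), ← div_eq_inv_mul, div_eq_inv_mul (f _),
      ENNReal.ofReal_mul (inv_nonneg.2 hσ.le)]
    ring
  rw [eLpNorm_two_sq, lintegral_congr hx, lintegral_const_mul' _ _ ENNReal.ofReal_ne_top,
    lintegral_comp_mul_left (fun y => ‖scaleScore f y‖ₑ ^ 2 * ENNReal.ofReal (f y))
      (inv_ne_zero hσ.ne'), inv_inv, abs_of_pos hσ, ← mul_assoc,
    ← ENNReal.ofReal_mul (by positivity), scoreEnergy]
  congr 2
  field_simp
  norm_num

lemma hasDerivAt_sqrtScaledDensity (hx : x ≠ 0) (hσ : 0 < σ) (hf : 0 < f (x / σ))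
    (hd : DifferentiableAt ℝ (fun y => y * f y) (x / σ)) :
    HasDerivAt (fun τ => sqrtScaledDensity f τ x) (sqrtScaledDensityDeriv f σ x) σ := by
  have hdiv : HasDerivAt (fun τ => x / τ) (-x / σ ^ 2) σ := by
    simpa only [div_eq_mul_inv, mul_neg, neg_mul] using (hasDerivAt_inv hσ.ne').const_mul x
  have hcomp : HasDerivAt (fun τ => x / τ * f (x / τ) / x)
      (deriv (fun y => y * f y) (x / σ) * (-x / σ ^ 2) / x) σ :=
    (HasDerivAt.comp σ hd.hasDerivAt hdiv).div_const x
  have heq : (fun τ => f (x / τ) / τ) =ᶠ[𝓝 σ] fun τ => x / τ * f (x / τ) / x := by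
    filter_upwards [lt_mem_nhds hσ] with τ hτ
    field_simp
  have hpos : 0 < f (x / σ) / σ := by positivity
  refine ((hcomp.congr_of_eventuallyEq heq).sqrt hpos.ne').congr_deriv ?_
  rw [div_eq_iff (by positivity), sqrtScaledDensityDeriv, scaleScoreAt, scaleScore,
    if_neg (div_ne_zero hx hσ.ne'), sqrtScaledDensity]
  calc deriv (fun y => y * f y) (x / σ) * (-x / σ ^ 2) / x
      = σ⁻¹ * (-deriv (fun y => y * f y) (x / σ) / f (x / σ)) * (f (x / σ) / σ) := by
        field_simp
    _ = σ⁻¹ * (-deriv (fun y => y * f y) (x / σ) / f (x / σ)) * √(f (x / σ) / σ) ^ 2 := by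
        rw [Real.sq_sqrt hpos.le]
    _ = _ := by ring

lemma eLpNorm_inv_smul_sqrtScaledDensity_sub_sq_le (hf : ∀ x, 0 ≤ f x)
    (hac : AbsolutelyContinuousOnLine fun x => x * f x) (hσ : 0 < σ) (hσt : 0 < σ + t)
    (ht : t ≠ 0) :
    eLpNorm (t⁻¹ • (sqrtScaledDensity f (σ + t) - sqrtScaledDensity f σ)) 2 volume ^ 2 ≤
      ENNReal.ofReal (1 / (4 * (σ * (σ + t)))) * scoreEnergy f := by
  rw [eLpNorm_const_smul, mul_pow, ← enorm_pow, Real.enorm_of_nonneg (sq_nonneg _)]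
  refine (mul_le_mul_right (eLpNorm_sqrtScaledDensity_sub_sq_le hf hac hσt hσ) _).trans_eq ?_
  rw [← mul_assoc, ← ENNReal.ofReal_mul (sq_nonneg _)]
  congr 2
  field_simp
  ring

lemma tendsto_eLpNorm_slope_sqrtScaledDensity (hfm : Measurable f) (hf : ∀ x, 0 ≤ f x)
    (hac : AbsolutelyContinuousOnLine fun x => x * f x) (hE : scoreEnergy f ≠ ∞) (hσ : 0 < σ) :
    Tendsto (fun t => eLpNorm (t⁻¹ • (sqrtScaledDensity f (σ + t) - sqrtScaledDensity f σ) -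
      sqrtScaledDensityDeriv f σ) 2 volume) (𝓝[≠] 0) (𝓝 0) := by
  have hfin : eLpNorm (sqrtScaledDensityDeriv f σ) 2 volume ^ 2 < ∞ := by
    rw [eLpNorm_sqrtScaledDensityDeriv_sq f hσ]
    exact ENNReal.mul_lt_top ENNReal.ofReal_lt_top hE.lt_top
  have hmem : MemLp (sqrtScaledDensityDeriv f σ) 2 volume :=
    ⟨(((measurable_scaleScoreAt hfm σ).div_const 2).mul
      (measurable_sqrtScaledDensity hfm σ)).aestronglyMeasurable,
      (ENNReal.pow_lt_top_iff.1 hfin).resolve_right two_ne_zero⟩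
  refine tendsto_eLpNorm_sub_zero
    (c := fun t => ENNReal.ofReal (1 / (4 * (σ * (σ + t)))) * scoreEnergy f)
    (fun t => (by fun_prop : Measurable _).aestronglyMeasurable) hmem ?_ ?_ ?_
  · filter_upwards [nhdsWithin_le_nhds (lt_mem_nhds (neg_lt_zero.2 hσ)), self_mem_nhdsWithin]
      with t ht ht0
    exact eLpNorm_inv_smul_sqrtScaledDensity_sub_sq_le hf hac hσ (neg_lt_iff_pos_add'.1 ht) ht0
  · rw [eLpNorm_sqrtScaledDensityDeriv_sq f hσ]
    refine ENNReal.Tendsto.mul_const (ENNReal.tendsto_ofReal ?_) (Or.inr hE)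
    have hcont : ContinuousAt (fun t : ℝ => 1 / (4 * (σ * (σ + t)))) 0 :=
      ContinuousAt.div continuousAt_const (by fun_prop) (by simp [hσ.ne'])
    simpa only [add_zero, ← sq] using hcont.tendsto.mono_left nhdsWithin_le_nhds
  · filter_upwards [ae_comp_div hac.ae_differentiableAt hσ.ne', Measure.ae_ne volume (0 : ℝ)]
      with x hd hx hne
    have hpos : 0 < f (x / σ) := (hf _).lt_of_ne fun h0 => hne <| by
      simp [sqrtScaledDensityDeriv, sqrtScaledDensity, ← h0]
    exact hasDerivAt_iff_tendsto_slope_zero.1 (hasDerivAt_sqrtScaledDensity hx hσ hpos hd)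

lemma IsScaleDensity.scoreEnergy_lt_top (hf : IsScaleDensity F f)
    (hΛ : MemLp (scaleScore f) 2 F) : scoreEnergy f < ∞ := by
  have hΛp : MemLp (scaleScore f) 2 (puncture F) := hΛ.restrict _
  have hscore := measurable_scaleScore hf.measurable
  have hsq := ENNReal.pow_lt_top (n := 2) hΛp.2
  rw [eLpNorm_two_sq, hf.density, lintegral_withDensity_eq_lintegral_mul _
    hf.measurable.ennreal_ofReal (by fun_prop)] at hsq
  simpa only [scoreEnergy, Pi.mul_apply, mul_comm] using hsq

lemma IsScaleDensity.memLp_scaleScoreAt (hf : IsScaleDensity F f)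
    (hΛ : MemLp (scaleScore f) 2 F) (hσ : σ ≠ 0) :
    MemLp (scaleScoreAt f σ) 2 (scaleFamily F σ) := by
  rw [scaleFamily, memLp_map_measure_iff
    (measurable_scaleScoreAt hf.measurable σ).aestronglyMeasurable (by fun_prop)]
  simpa only [Function.comp_def, scaleScoreAt, mul_div_cancel_left₀ _ hσ] using hΛ.const_mul σ⁻¹

variable [IsFiniteMeasure F]

lemma IsScaleDensity.sqrtMeasureDist_scaleFamily_add (hf : IsScaleDensity F f) (hσ : 0 < σ)
    (hσt : 0 < σ + t) :
    sqrtMeasureDist (scaleFamily F (σ + t)) (scaleFamily F σ)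
        (fun x => 1 + t / 2 * scaleScoreAt f σ x) =
      eLpNorm (sqrtScaledDensity f (σ + t) - sqrtScaledDensity f σ -
        t • sqrtScaledDensityDeriv f σ) 2 volume := by
  have hm := measurable_scaleScoreAt hf.measurable σ
  rw [hf.sqrtMeasureDist_scaleFamily hσ hσt (by fun_prop) (by simp [scaleScoreAt, scaleScore])]
  congr 1
  ext x
  simp only [Pi.sub_apply, Pi.smul_apply, smul_eq_mul, sqrtScaledDensityDeriv]
  ring

theorem IsScaleDensity.hasL2DerivAt (hf : IsScaleDensity F f) (hΛ : MemLp (scaleScore f) 2 F)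
    (hσ : 0 < σ) : HasL2DerivAt (scaleFamily F) (scaleScoreAt f σ) σ := by
  refine ⟨hf.memLp_scaleScoreAt hΛ hσ.ne', ?_⟩
  have hslope := tendsto_eLpNorm_slope_sqrtScaledDensity hf.measurable hf.nonneg hf.absCont
    (hf.scoreEnergy_lt_top hΛ).ne hσ
  rw [← nhdsNE_sup_pure, isLittleO_sup, isLittleO_pure]
  refine ⟨isLittleO_abs_right.1 (isLittleO_iff_exists_eq_mul.2
    ⟨_, (ENNReal.tendsto_toReal ENNReal.zero_ne_top).comp hslope, ?_⟩), ?_⟩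
  · filter_upwards [nhdsWithin_le_nhds (lt_mem_nhds (neg_lt_zero.2 hσ)), self_mem_nhdsWithin]
      with t ht ht0
    rw [hf.sqrtMeasureDist_scaleFamily_add hσ (neg_lt_iff_pos_add'.1 ht)]
    have hsmul : sqrtScaledDensity f (σ + t) - sqrtScaledDensity f σ -
        t • sqrtScaledDensityDeriv f σ =
          t • (t⁻¹ • (sqrtScaledDensity f (σ + t) - sqrtScaledDensity f σ) -
            sqrtScaledDensityDeriv f σ) := by
      rw [smul_sub, smul_inv_smul₀ ht0]
    rw [hsmul, eLpNorm_const_smul, ENNReal.toReal_mul, toReal_enorm, Real.norm_eq_abs, mul_comm]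
    rfl
  · rw [hf.sqrtMeasureDist_scaleFamily_add hσ (by simpa using hσ)]
    simp

end Differentiability

theorem proposition3p1_general (F : Measure ℝ) [IsFiniteMeasure F]
    (hF : fisherInfoScale F < ∞) :
    (∃ f : ℝ → ℝ, IsScaleDensity F f) ∧
      ∀ f : ℝ → ℝ, IsScaleDensity F f →
        ∀ σ : ℝ, 0 < σ → HasL2DerivAt (scaleFamily F) (scaleScoreAt f σ) σ :=
  ⟨exists_isScaleDensity hF, fun _ hf _ hσ => hf.hasL2DerivAt (hf.memLp_scaleScore hF) hσ⟩

theorem proposition3p1 (F : Measure ℝ) [IsProbabilityMeasure F]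
    (hF : fisherInfoScale F < ∞) :
    (∃ f : ℝ → ℝ, IsScaleDensity F f) ∧
      ∀ f : ℝ → ℝ, IsScaleDensity F f →
        ∀ σ : ℝ, 0 < σ → HasL2DerivAt (scaleFamily F) (scaleScoreAt f σ) σ :=
  proposition3p1_general F hF
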